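/- For $r\in(0,1)$ write $r^\ast=1-r$. The \emph{Giry monoidal structure} on $\mathbf{Set}$ is the symmetric monoidal structure with tensor $$A\star B \;=\; A+\big((0,1)\times A\times B\big)+B,\qquad f\star g=f+\big((0,1)\times f\times g\big)+g,$$ with unit $\emptyset$ and the evident unit constraints. Write $\iota_1(a)$, $(r,a,b)$, $\iota_2(b)$ for the elements of the three summands. The associativity constraint $(A\star B)\star C\to A\star(B\star C)$ sends $(r,(s,a,b),c)$ to $\big(rs,\,a,\,(\tfrac{r s^\ast}{(rs)^\ast},b,c)\big)$ and is the identity between corresponding summands otherwise (the summands $A$, $B$, $C$, $(0,1)\times A\times B$, $(0,1)\times A\times C$, $(0,1)\times B\times C$). The symmetry $A\star B\to B\star A$ exchanges the outer summands and sends $(r,a,b)$ to $(r^\ast,b,a)$. The \emph{finite Giry monad} $D$ on $\mathbf{Set}$ sends $A$ to the set of finitely supported probability distributions on $A$, and a function to pushforward along it; its unit sends $a$ to the point mass at $a$, and its multiplication sends $\sum_i\lambda_i\cdot\omega_i$ to $a\mapsto\sum_i\lambda_i\omega_i(a)$. A \emph{symmetric opmonoidal} structure on a monad $T$ on a symmetric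 monoidal category $(\mathcal C,\otimes,I)$ consists of maps $\upsilon_I\colon TI\to I$ and natural maps $\upsilon_{XY}\colon T(X\otimes Y)\to TX\otimes TY$ making $T$ a symmetric opmonoidal functor, such that the unit and the multiplication of $T$ are opmonoidal transformations. The symmetric monoidal structure of $\mathcal C$ then lifts to the category $\mathcal C^T$ of $T$-algebras: the unit is $\upsilon_I\colon TI\to I$, the tensor of $x\colon TX\to X$ and $y\colon TY\to Y$ is $(x\otimes y)\circ\upsilon_{XY}\colon T(X\otimes Y)\to X\otimes Y$, and the tensor of maps and the constraints are those of $\mathcal C$. The monad $T$ is a \emph{linear exponential monad} if this lifted symmetric monoidal structure on $\mathcal C^T$ is given by finite coproducts, i.e. its unit is initial, its tensor is binary coproduct, and its action on maps and its constraints are the ones induced by the universal properties. \textbf{Proposition.} With respect to the Giry monoidal structure on $\mathbf{Set}$, the finite Giry monad $D$ is a linear exponential monad. In other words, the Giry monoidal structure lifts along the forgetful functor $U\colon\mathbf{Set}^D\to\mathbf{Set}$ from $D$-algebras (convex spaces), so that $U$ is strict symmetric monoidal, and the lifted structure on $\mathbf{Set}^D$ is that of finite coproducts. More precisely, this holds for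 a symmetric opmonoidal structure on $D$ such that, for all $D$-algebras $X$ and $Y$, the coproduct injections into the algebra $X\star Y$ are $\iota_1$ and $\iota_2$, and the convex combination $r\cdot\iota_1(x)+r^\ast\cdot\iota_2(y)$ computed in $X\star Y$ is $(r,x,y)$, for all $r\in(0,1)$, $x\in X$, $y\in Y$. -/

import Mathlib

open CategoryTheory MonoidalCategory Limits

universe v u v' u'

section Opmonoidal

variable {C : Type u} [Category.{v} C] [MonoidalCategory C] [SymmetricCategory C]

/-- A symmetric opmonoidal structure on a monad `T` on a symmetric monoidal category: maps
`υ_I : T I ⟶ I` (the field `η` of `oplax`) and `υ_{X,Y} : T (X ⊗ Y) ⟶ T X ⊗ T Y` (the field `δ` of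
`oplax`) making `T` a symmetric opmonoidal functor, for which the unit and the multiplication of
the monad are opmonoidal natural transformations. -/
structure SymmetricOpmonoidalMonad (T : Monad C) where
  oplax : T.toFunctor.OplaxMonoidal
  braided : ∀ X Y : C, oplax.δ X Y ≫ (β_ (T.obj X) (T.obj Y)).hom =
    T.map (β_ X Y).hom ≫ oplax.δ Y X
  unit_counit : T.η.app (𝟙_ C) ≫ oplax.η = 𝟙 (𝟙_ C)
  unit_tensor : ∀ X Y : C, T.η.app (X ⊗ Y) ≫ oplax.δ X Y = T.η.app X ⊗ₘ T.η.app Y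
  mul_counit : T.μ.app (𝟙_ C) ≫ oplax.η = T.map oplax.η ≫ oplax.η
  mul_tensor : ∀ X Y : C, T.μ.app (X ⊗ Y) ≫ oplax.δ X Y =
    T.map (oplax.δ X Y) ≫ oplax.δ (T.obj X) (T.obj Y) ≫ (T.μ.app X ⊗ₘ T.μ.app Y)

namespace SymmetricOpmonoidalMonad

variable {T : Monad C} (S : SymmetricOpmonoidalMonad T)

theorem δ_natural {X Y X' Y' : C} (f : X ⟶ X') (g : Y ⟶ Y') :
    S.oplax.δ X Y ≫ (T.map f ⊗ₘ T.map g) = T.map (f ⊗ₘ g) ≫ S.oplax.δ X' Y' := by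
  let := S.oplax
  exact Functor.OplaxMonoidal.δ_natural T.toFunctor f g

/-- The lifted tensor product of two algebras: the carrier is `X ⊗ Y`, and the action is
`T (X ⊗ Y) ⟶ T X ⊗ T Y ⟶ X ⊗ Y`. -/
abbrev tensorAlgebra (X Y : T.Algebra) : T.Algebra where
  A := X.A ⊗ Y.A
  a := S.oplax.δ X.A Y.A ≫ (X.a ⊗ₘ Y.a)
  unit := by
    rw [← Category.assoc, S.unit_tensor, tensorHom_comp_tensorHom, X.unit, Y.unit]
    simp
  assoc := by
    rw [← Category.assoc, S.mul_tensor, Functor.map_comp, Category.assoc, Category.assoc,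
      Category.assoc, tensorHom_comp_tensorHom, X.assoc, Y.assoc, ← tensorHom_comp_tensorHom,
      ← Category.assoc (S.oplax.δ (T.obj X.A) (T.obj Y.A)), S.δ_natural, Category.assoc]

/-- The lifted unit object: the carrier is `I`, and the action is `υ_I`. -/
abbrev unitAlgebra : T.Algebra where
  A := 𝟙_ C
  a := S.oplax.η
  unit := S.unit_counit
  assoc := S.mul_counit

/-- The lifted tensor product of two algebra maps. -/
abbrev tensorAlgebraHom {X X' Y Y' : T.Algebra} (f : X ⟶ X') (g : Y ⟶ Y') :
    S.tensorAlgebra X Y ⟶ S.tensorAlgebra X' Y' where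
  f := f.f ⊗ₘ g.f
  h := by
    rw [← Category.assoc, ← S.δ_natural, Category.assoc, Category.assoc,
      tensorHom_comp_tensorHom, tensorHom_comp_tensorHom, f.h, g.h]

theorem associator_action (X Y Z : T.Algebra) :
    T.map (α_ X.A Y.A Z.A).hom ≫ (S.tensorAlgebra X (S.tensorAlgebra Y Z)).a =
      (S.tensorAlgebra (S.tensorAlgebra X Y) Z).a ≫ (α_ X.A Y.A Z.A).hom := by
  have h := S.oplax.oplax_associativity X.A Y.A Z.A
  have e1 : (X.a ⊗ₘ S.oplax.δ Y.A Z.A ≫ (Y.a ⊗ₘ Z.a)) =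
      (T.obj X.A ◁ S.oplax.δ Y.A Z.A) ≫ (X.a ⊗ₘ (Y.a ⊗ₘ Z.a)) := by
    rw [← id_tensorHom, tensorHom_comp_tensorHom, Category.id_comp]
  have e2 : ((S.oplax.δ X.A Y.A ≫ (X.a ⊗ₘ Y.a)) ⊗ₘ Z.a) =
      (S.oplax.δ X.A Y.A ▷ T.obj Z.A) ≫ ((X.a ⊗ₘ Y.a) ⊗ₘ Z.a) := by
    rw [← tensorHom_id, tensorHom_comp_tensorHom, Category.id_comp]
  change T.map (α_ X.A Y.A Z.A).hom ≫ S.oplax.δ X.A (Y.A ⊗ Z.A) ≫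
      (X.a ⊗ₘ S.oplax.δ Y.A Z.A ≫ (Y.a ⊗ₘ Z.a)) =
    (S.oplax.δ (X.A ⊗ Y.A) Z.A ≫ ((S.oplax.δ X.A Y.A ≫ (X.a ⊗ₘ Y.a)) ⊗ₘ Z.a)) ≫
      (α_ X.A Y.A Z.A).hom
  rw [e1, e2]
  simp only [Category.assoc]
  rw [associator_naturality]
  simpa only [Category.assoc] using (congrArg (· ≫ (X.a ⊗ₘ (Y.a ⊗ₘ Z.a))) h).symm

theorem leftUnitor_action (X : T.Algebra) :
    T.map (λ_ X.A).hom ≫ X.a = (S.tensorAlgebra S.unitAlgebra X).a ≫ (λ_ X.A).hom := by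
  let := S.oplax
  have h := Functor.OplaxMonoidal.left_unitality_hom T.toFunctor X.A
  change _ = (S.oplax.δ (𝟙_ C) X.A ≫ (S.oplax.η ⊗ₘ X.a)) ≫ (λ_ X.A).hom
  rw [← h, MonoidalCategory.tensorHom_def]
  simp only [Category.assoc, leftUnitor_naturality]

theorem rightUnitor_action (X : T.Algebra) :
    T.map (ρ_ X.A).hom ≫ X.a = (S.tensorAlgebra X S.unitAlgebra).a ≫ (ρ_ X.A).hom := by
  let := S.oplax
  have h := Functor.OplaxMonoidal.right_unitality_hom T.toFunctor X.A
  change _ = (S.oplax.δ X.A (𝟙_ C) ≫ (X.a ⊗ₘ S.oplax.η)) ≫ (ρ_ X.A).hom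
  rw [← h, MonoidalCategory.tensorHom_def']
  simp only [Category.assoc, rightUnitor_naturality]

theorem braiding_action (X Y : T.Algebra) :
    T.map (β_ X.A Y.A).hom ≫ (S.tensorAlgebra Y X).a =
      (S.tensorAlgebra X Y).a ≫ (β_ X.A Y.A).hom := by
  rw [← Category.assoc, ← S.braided, Category.assoc, Category.assoc,
    BraidedCategory.braiding_naturality]

/-- The data of the lifted monoidal structure on algebras: all of it lies over the data of `C`. -/
abbrev liftedStruct : MonoidalCategoryStruct T.Algebra where
  tensorObj X Y := S.tensorAlgebra X Y
  tensorUnit := S.unitAlgebra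
  tensorHom f g := S.tensorAlgebraHom f g
  whiskerLeft X _ _ g := S.tensorAlgebraHom (𝟙 X) g
  whiskerRight f Y := S.tensorAlgebraHom f (𝟙 Y)
  associator X Y Z := Monad.Algebra.isoMk (α_ X.A Y.A Z.A) (S.associator_action X Y Z)
  leftUnitor X := Monad.Algebra.isoMk (λ_ X.A) (S.leftUnitor_action X)
  rightUnitor X := Monad.Algebra.isoMk (ρ_ X.A) (S.rightUnitor_action X)

/-- The lifted monoidal structure on algebras. -/
abbrev liftedMonoidal : MonoidalCategory T.Algebra :=
  letI := S.liftedStruct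
  .ofTensorHom
    (id_tensorHom_id := fun X Y => Monad.Algebra.Hom.ext (id_tensorHom_id X.A Y.A))
    (id_tensorHom := fun _ _ _ _ => rfl)
    (tensorHom_id := fun _ _ => rfl)
    (tensorHom_comp_tensorHom := fun f₁ f₂ g₁ g₂ =>
      Monad.Algebra.Hom.ext (tensorHom_comp_tensorHom f₁.f f₂.f g₁.f g₂.f))
    (associator_naturality := fun f g h =>
      Monad.Algebra.Hom.ext (associator_naturality f.f g.f h.f))
    (leftUnitor_naturality := fun f => Monad.Algebra.Hom.ext
      ((congrArg (· ≫ _) (id_tensorHom _ f.f)).trans (leftUnitor_naturality f.f)))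
    (rightUnitor_naturality := fun f => Monad.Algebra.Hom.ext
      ((congrArg (· ≫ _) (tensorHom_id f.f _)).trans (rightUnitor_naturality f.f)))
    (pentagon := fun W X Y Z => Monad.Algebra.Hom.ext <| by
      have h := MonoidalCategory.pentagon W.A X.A Y.A Z.A
      rw [← id_tensorHom, ← tensorHom_id] at h
      exact h)
    (triangle := fun X Y => Monad.Algebra.Hom.ext <| by
      have h := MonoidalCategory.triangle X.A Y.A
      rw [← id_tensorHom, ← tensorHom_id] at h
      exact h)

/-- The lifted symmetry on algebras. -/
abbrev liftedSymmetric :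
    letI := S.liftedMonoidal
    SymmetricCategory T.Algebra :=
  letI := S.liftedMonoidal
  { braiding := fun X Y => Monad.Algebra.isoMk (β_ X.A Y.A) (S.braiding_action X Y)
    braiding_naturality_right := fun X _ _ f => Monad.Algebra.Hom.ext <| by
      have h := BraidedCategory.braiding_naturality_right X.A f.f
      rw [← id_tensorHom, ← tensorHom_id] at h
      exact h
    braiding_naturality_left := fun f Z => Monad.Algebra.Hom.ext <| by
      have h := BraidedCategory.braiding_naturality_left f.f Z.A
      rw [← id_tensorHom, ← tensorHom_id] at h
      exact h
    hexagon_forward := fun X Y Z => Monad.Algebra.Hom.ext <| by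
      have h := BraidedCategory.hexagon_forward X.A Y.A Z.A
      rw [← id_tensorHom, ← tensorHom_id] at h
      exact h
    hexagon_reverse := fun X Y Z => Monad.Algebra.Hom.ext <| by
      have h := BraidedCategory.hexagon_reverse X.A Y.A Z.A
      rw [← id_tensorHom, ← tensorHom_id] at h
      exact h
    symmetry := fun X Y => Monad.Algebra.Hom.ext (SymmetricCategory.symmetry X.A Y.A) }

end SymmetricOpmonoidalMonad

end Opmonoidal
section Linear

variable (C : Type u) [Category.{v} C] [MonoidalCategory C] [SymmetricCategory C]

/-- The symmetric monoidal structure of `C` is given by finite coproducts: the unit is an initial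
object, `X ⊗ Y` is a coproduct of `X` and `Y` with injections `inl` and `inr`, and the tensor
product of maps and all the constraint isomorphisms are the ones that the universal properties
induce. -/
structure FiniteCoproductStructure where
  isInitialUnit : IsInitial (𝟙_ C)
  inl (X Y : C) : X ⟶ X ⊗ Y
  inr (X Y : C) : Y ⟶ X ⊗ Y
  isColimit (X Y : C) : IsColimit (BinaryCofan.mk (inl X Y) (inr X Y))
  inl_tensorHom {X Y X' Y' : C} (f : X ⟶ X') (g : Y ⟶ Y') :
    inl X Y ≫ (f ⊗ₘ g) = f ≫ inl X' Y'
  inr_tensorHom {X Y X' Y' : C} (f : X ⟶ X') (g : Y ⟶ Y') :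
    inr X Y ≫ (f ⊗ₘ g) = g ≫ inr X' Y'
  inr_leftUnitor (X : C) : inr (𝟙_ C) X ≫ (λ_ X).hom = 𝟙 X
  inl_rightUnitor (X : C) : inl X (𝟙_ C) ≫ (ρ_ X).hom = 𝟙 X
  inl_inl_associator (X Y Z : C) :
    inl X Y ≫ inl (X ⊗ Y) Z ≫ (α_ X Y Z).hom = inl X (Y ⊗ Z)
  inr_inl_associator (X Y Z : C) :
    inr X Y ≫ inl (X ⊗ Y) Z ≫ (α_ X Y Z).hom = inl Y Z ≫ inr X (Y ⊗ Z)
  inr_associator (X Y Z : C) :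
    inr (X ⊗ Y) Z ≫ (α_ X Y Z).hom = inr Y Z ≫ inr X (Y ⊗ Z)
  inl_braiding (X Y : C) : inl X Y ≫ (β_ X Y).hom = inr Y X
  inr_braiding (X Y : C) : inr X Y ≫ (β_ X Y).hom = inl Y X

variable {C}

/-- A linear exponential monad on a symmetric monoidal category: a symmetric opmonoidal monad whose
lifted symmetric monoidal structure on the category of algebras is given by finite coproducts. -/
structure LinearExponentialMonad (T : Monad C) extends SymmetricOpmonoidalMonad T where
  coproducts :
    letI := toSymmetricOpmonoidalMonad.liftedMonoidal
    letI := toSymmetricOpmonoidalMonad.liftedSymmetric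
    FiniteCoproductStructure T.Algebra

/-- A functor between symmetric monoidal categories is strict symmetric monoidal: it preserves the
unit, the tensor product of objects and of maps, and all the constraint isomorphisms on the
nose. -/
structure IsStrictSymmetricMonoidal {D : Type u'} [Category.{v'} D] [MonoidalCategory D]
    [SymmetricCategory D] (F : C ⥤ D) : Prop where
  unit : F.obj (𝟙_ C) = 𝟙_ D
  tensor (X Y : C) : F.obj (X ⊗ Y) = F.obj X ⊗ F.obj Y
  tensorHom {X Y X' Y' : C} (f : X ⟶ X') (g : Y ⟶ Y') :
    F.map (f ⊗ₘ g) =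
      eqToHom (tensor X Y) ≫ (F.map f ⊗ₘ F.map g) ≫ eqToHom (tensor X' Y').symm
  associator (X Y Z : C) :
    F.map (α_ X Y Z).hom =
      eqToHom (by rw [tensor, tensor]) ≫ (α_ (F.obj X) (F.obj Y) (F.obj Z)).hom ≫
        eqToHom (by rw [tensor, tensor])
  leftUnitor (X : C) :
    F.map (λ_ X).hom = eqToHom (by rw [tensor, unit]) ≫ (λ_ (F.obj X)).hom
  rightUnitor (X : C) :
    F.map (ρ_ X).hom = eqToHom (by rw [tensor, unit]) ≫ (ρ_ (F.obj X)).hom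
  braiding (X Y : C) :
    F.map (β_ X Y).hom =
      eqToHom (tensor X Y) ≫ (β_ (F.obj X) (F.obj Y)).hom ≫ eqToHom (tensor Y X).symm

end Linear

namespace Giry

/-- The open unit interval `(0,1)`. -/
abbrev Weight : Type := Set.Ioo (0 : ℝ) 1

/-- `r ↦ r* = 1 - r` on `(0,1)`. -/
def compl (r : Weight) : Weight :=
  ⟨1 - r.1, by have := r.2.1; have := r.2.2; constructor <;> linarith⟩

/-- The first component `r s` of `v (r, s)`. -/
def vFst (r s : Weight) : Weight :=
  ⟨r.1 * s.1, mul_pos r.2.1 s.2.1, by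
    have := r.2.1; have := r.2.2; have := s.2.1; have := s.2.2; nlinarith⟩

/-- The second component `r s* / (r s)*` of `v (r, s)`. -/
noncomputable def vSnd (r s : Weight) : Weight :=
  ⟨r.1 * (1 - s.1) / (1 - r.1 * s.1), by
    have h1 := r.2.1
    have h2 := r.2.2
    have h3 := s.2.1
    have h4 := s.2.2
    have h5 : 0 < 1 - r.1 * s.1 := by nlinarith
    refine ⟨div_pos (mul_pos h1 (by linarith)) h5, ?_⟩
    rw [div_lt_one h5]
    nlinarith⟩

/-- The first component `p + q p*` of `v⁻¹ (p, q)`. -/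
def vInvFst (p q : Weight) : Weight :=
  ⟨p.1 + q.1 * (1 - p.1), by
    have := p.2.1; have := p.2.2; have := q.2.1; have := q.2.2
    constructor <;> nlinarith⟩

/-- The second component `p / (p + q p*)` of `v⁻¹ (p, q)`. -/
noncomputable def vInvSnd (p q : Weight) : Weight :=
  ⟨p.1 / (p.1 + q.1 * (1 - p.1)), by
    have h1 := p.2.1
    have h2 := p.2.2
    have h3 := q.2.1
    have h5 : 0 < q.1 * (1 - p.1) := mul_pos h3 (by linarith)
    refine ⟨div_pos h1 (by linarith), ?_⟩
    rw [div_lt_one (by linarith)]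
    linarith⟩

theorem mul_ne_one' (r s : Weight) : 1 - r.1 * s.1 ≠ 0 :=
  (sub_pos.2 (vFst r s).2.2).ne'

theorem den_ne (p q : Weight) : p.1 + q.1 * (1 - p.1) ≠ 0 := (vInvFst p q).2.1.ne'

theorem vInvFst_v (r s : Weight) : vInvFst (vFst r s) (vSnd r s) = r := by
  have h := mul_ne_one' r s
  apply Subtype.ext
  simp only [vInvFst, vFst, vSnd]
  field_simp
  ring

theorem vInvSnd_v (r s : Weight) : vInvSnd (vFst r s) (vSnd r s) = s := by
  have h := congrArg Subtype.val (vInvFst_v r s)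
  apply Subtype.ext
  simp only [vInvFst, vFst, vSnd] at h
  simp only [vInvSnd, vFst, vSnd, h]
  have := r.2.1.ne'
  field_simp

theorem vFst_vInv (p q : Weight) : vFst (vInvFst p q) (vInvSnd p q) = p := by
  have h := den_ne p q
  apply Subtype.ext
  simp only [vInvFst, vFst, vInvSnd]
  field_simp

theorem vSnd_vInv (p q : Weight) : vSnd (vInvFst p q) (vInvSnd p q) = q := by
  have h := den_ne p q
  have h2 : 1 - p.1 ≠ 0 := (compl p).2.1.ne'
  apply Subtype.ext
  simp only [vInvFst, vSnd, vInvSnd]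
  rw [mul_div_cancel₀ _ h, mul_sub, mul_div_cancel₀ _ h]
  field_simp
  ring

/-- The three components of the tricocycloid axiom for `v`. -/
theorem tri₁ (r s t : Weight) : vFst (vFst r s) t = vFst r (vFst s t) := by
  apply Subtype.ext; simp only [vFst]; ring

theorem tri₂ (r s t : Weight) :
    vSnd (vFst r s) t = vFst (vSnd r (vFst s t)) (vSnd s t) := by
  have h1 := mul_ne_one' s t
  have h2 := mul_ne_one' r (vFst s t)
  have h3 := mul_ne_one' (vFst r s) t
  apply Subtype.ext
  simp only [vFst, vSnd] at *
  field_simp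

theorem tri₃ (r s t : Weight) :
    vSnd r s = vSnd (vSnd r (vFst s t)) (vSnd s t) := by
  have h1 := mul_ne_one' s t
  have h2 := mul_ne_one' r (vFst s t)
  have h4 := mul_ne_one' r s
  have h3 := mul_ne_one' (vSnd r (vFst s t)) (vSnd s t)
  have h5 : 1 - (vFst (vSnd r (vFst s t)) (vSnd s t)).1 =
      (1 - r.1 * s.1) / (1 - r.1 * (s.1 * t.1)) := by
    rw [← tri₂]; simp only [vFst, vSnd] at *
    rw [← mul_assoc] at *
    field_simp; ring
  apply Subtype.ext
  simp only [vFst, vSnd] at *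
  rw [h5]
  rw [← mul_assoc] at h2 ⊢
  have h6 : 1 - s.1 * (1 - t.1) / (1 - s.1 * t.1) = (1 - s.1) / (1 - s.1 * t.1) := by
    field_simp
    ring
  rw [h6]
  field_simp

theorem compl_compl (r : Weight) : compl (compl r) = r := by
  apply Subtype.ext; simp [compl]

/-- The two components of the symmetry axiom for `r ↦ r*`. -/
theorem sym₁ (r s : Weight) :
    vFst r (compl s) = vFst (compl (vFst r s)) (vSnd r s) := by
  have h := mul_ne_one' r s
  apply Subtype.ext
  simp only [vFst, vSnd, compl] at *
  field_simp

theorem sym₂ (r s : Weight) :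
    compl (vSnd r (compl s)) = vSnd (compl (vFst r s)) (vSnd r s) := by
  have h := mul_ne_one' r s
  have h2 := mul_ne_one' r (compl s)
  have h3 : (1 - r.1 * s.1) * (r.1 * (1 - s.1) / (1 - r.1 * s.1)) = r.1 * (1 - s.1) := by
    field_simp
  apply Subtype.ext
  simp only [vFst, vSnd, compl] at *
  rw [h3, mul_sub (1 - r.1 * s.1), h3]
  field_simp
  ring

/-- `A ⋆ B = A + (0,1) × A × B + B`. -/
abbrev Star (A B : Type u) : Type u := A ⊕ (Weight × A × B) ⊕ B

/-- `f ⋆ g = f + (0,1) × f × g + g`. -/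
def starMap {A A' B B' : Type u} (f : A → A') (g : B → B') : Star A B → Star A' B' :=
  Sum.map f (Sum.map (Prod.map id (Prod.map f g)) g)

/-- The associativity constraint: it is the identity on the summands `A`, `B`, `C`, `HAB`, `HAC`,
`HBC` (with `H = (0,1)`), and is given by `v` on the summand `HHABC`. -/
noncomputable def assocFun {A B C : Type u} : Star (Star A B) C → Star A (Star B C)
  | .inl (.inl a) => .inl a
  | .inl (.inr (.inl (r, a, b))) => .inr (.inl (r, a, .inl b))
  | .inl (.inr (.inr b)) => .inr (.inr (.inl b))
  | .inr (.inl (r, .inl a, c)) => .inr (.inl (r, a, .inr (.inr c)))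
  | .inr (.inl (r, .inr (.inl (s, a, b)), c)) =>
      .inr (.inl (vFst r s, a, .inr (.inl (vSnd r s, b, c))))
  | .inr (.inl (r, .inr (.inr b), c)) => .inr (.inr (.inr (.inl (r, b, c))))
  | .inr (.inr c) => .inr (.inr (.inr (.inr c)))

/-- The inverse of the associativity constraint. -/
noncomputable def assocInv {A B C : Type u} : Star A (Star B C) → Star (Star A B) C
  | .inl a => .inl (.inl a)
  | .inr (.inl (r, a, .inl b)) => .inl (.inr (.inl (r, a, b)))
  | .inr (.inr (.inl b)) => .inl (.inr (.inr b))
  | .inr (.inl (r, a, .inr (.inr c))) => .inr (.inl (r, .inl a, c))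
  | .inr (.inl (p, a, .inr (.inl (q, b, c)))) =>
      .inr (.inl (vInvFst p q, .inr (.inl (vInvSnd p q, a, b)), c))
  | .inr (.inr (.inr (.inl (r, b, c)))) => .inr (.inl (r, .inr (.inr b), c))
  | .inr (.inr (.inr (.inr c))) => .inr (.inr c)

/-- The associativity constraint as a bijection. -/
noncomputable def assocEquiv (A B C : Type u) : Star (Star A B) C ≃ Star A (Star B C) where
  toFun := assocFun
  invFun := assocInv
  left_inv := by
    rintro ((a | ⟨r, a, b⟩ | b) | ⟨r, a | ⟨s, a, b⟩ | b, c⟩ | c) <;>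
      simp [assocFun, assocInv, vInvFst_v, vInvSnd_v]
  right_inv := by
    rintro (a | ⟨r, a, b | ⟨s, b, c⟩ | c⟩ | b | ⟨r, b, c⟩ | c) <;>
      simp [assocFun, assocInv, vFst_vInv, vSnd_vInv]

/-- The left unit constraint `0 ⋆ A ≅ A`. -/
def leftUnitEquiv (A : Type u) : Star PEmpty.{u + 1} A ≃ A where
  toFun
    | .inl e => e.elim
    | .inr (.inl (_, e, _)) => e.elim
    | .inr (.inr a) => a
  invFun a := .inr (.inr a)
  left_inv := by rintro (⟨⟨⟩⟩ | ⟨_, ⟨⟩, _⟩ | a); rfl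
  right_inv _ := rfl

/-- The right unit constraint `A ⋆ 0 ≅ A`. -/
def rightUnitEquiv (A : Type u) : Star A PEmpty.{u + 1} ≃ A where
  toFun
    | .inl a => a
    | .inr (.inl (_, _, e)) => e.elim
    | .inr (.inr e) => e.elim
  invFun a := .inl a
  left_inv := by rintro (a | ⟨_, _, ⟨⟩⟩ | ⟨⟨⟩⟩); rfl
  right_inv _ := rfl

/-- The symmetry `A ⋆ B → B ⋆ A`, given by `r ↦ r*` on the middle summand. -/
def swapFun {A B : Type u} : Star A B → Star B A
  | .inl a => .inr (.inr a)
  | .inr (.inl (r, a, b)) => .inr (.inl (compl r, b, a))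
  | .inr (.inr b) => .inl b

theorem swapFun_swapFun {A B : Type u} (x : Star A B) : swapFun (swapFun x) = x := by
  rcases x with a | ⟨r, a, b⟩ | b <;> simp [swapFun, compl_compl]

/-- The symmetry as a bijection. -/
def swapEquiv (A B : Type u) : Star A B ≃ Star B A where
  toFun := swapFun
  invFun := swapFun
  left_inv := swapFun_swapFun
  right_inv := swapFun_swapFun

/-- The data of the Giry monoidal structure `(⋆, 0)` on sets. -/
noncomputable abbrev monoidalStruct : MonoidalCategoryStruct (Type u) where
  tensorObj A B := Star A B
  tensorUnit := PEmpty
  tensorHom f g := ↾(starMap f g)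
  whiskerLeft _ _ _ g := ↾(starMap id g)
  whiskerRight f _ := ↾(starMap f id)
  associator A B C := (assocEquiv A B C).toIso
  leftUnitor A := (leftUnitEquiv A).toIso
  rightUnitor A := (rightUnitEquiv A).toIso

theorem starMap_id {A B : Type u} (x : Star A B) : starMap id id x = x := by
  rcases x with a | ⟨r, a, b⟩ | b <;> rfl

theorem starMap_comp {A A' A'' B B' B'' : Type u} (f : A → A') (f' : A' → A'') (g : B → B')
    (g' : B' → B'') (x : Star A B) :
    starMap f' g' (starMap f g x) = starMap (f' ∘ f) (g' ∘ g) x := by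
  rcases x with a | ⟨r, a, b⟩ | b <;> rfl

theorem assoc_natural {A A' B B' C C' : Type u} (f : A → A') (g : B → B') (h : C → C')
    (x : Star (Star A B) C) :
    assocFun (starMap (starMap f g) h x) = starMap f (starMap g h) (assocFun x) := by
  rcases x with (a | ⟨r, a, b⟩ | b) | ⟨r, a | ⟨s, a, b⟩ | b, c⟩ | c <;> rfl

theorem assoc_pentagon {A B C D : Type u} (x : Star (Star (Star A B) C) D) :
    starMap id assocFun (assocFun (starMap assocFun id x)) =
      (assocFun (assocFun x) : Star A (Star B (Star C D))) := by
  rcases x with ((a | ⟨r, a, b⟩ | b) | ⟨r, a | ⟨s, a, b⟩ | b, c⟩ | c) |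
      ⟨t, (a | ⟨r, a, b⟩ | b) | ⟨r, a | ⟨s, a, b⟩ | b, c⟩ | c, d⟩ | d <;>
    first
    | rfl
    | simp [starMap, assocFun, tri₁, ← tri₂, ← tri₃]

theorem hexagon {A B C : Type u} (x : Star (Star A B) C) :
    (assocFun (swapFun (assocFun x)) : Star B (Star C A)) =
      starMap id swapFun (assocFun (starMap swapFun id x)) := by
  rcases x with (a | ⟨r, a, b⟩ | b) | ⟨r, a | ⟨s, a, b⟩ | b, c⟩ | c <;>
    first
    | rfl
    | simp [starMap, assocFun, swapFun, ← sym₁, ← sym₂]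

theorem hexagon_inv {A B C : Type u} (x : Star A (Star B C)) :
    (assocInv (swapFun (assocInv x)) : Star (Star C A) B) =
      starMap swapFun id (assocInv (starMap id swapFun x)) := by
  have e : ∀ {A B : Type u}, swapFun ∘ (swapFun : Star A B → Star B A) = id :=
    funext swapFun_swapFun
  have h := hexagon (starMap swapFun id (assocInv (starMap id swapFun x)))
  have h₁ : ∀ y : Star A (Star C B), assocFun (assocInv y) = y := (assocEquiv A C B).right_inv
  have h₂ : ∀ y : Star (Star A B) C, assocInv (assocFun y) = y := (assocEquiv A B C).left_inv
  have h₃ : ∀ y : Star (Star C A) B, assocInv (assocFun y) = y := (assocEquiv C A B).left_inv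
  rw [starMap_comp, e, Function.id_comp, starMap_id, h₁, starMap_comp, e, Function.id_comp,
    starMap_id] at h
  rw [← h, h₂, swapFun_swapFun, h₃, h]

/-- The Giry monoidal structure `(⋆, 0)` on sets. -/
noncomputable abbrev monoidal : MonoidalCategory (Type u) :=
  letI := monoidalStruct.{u}
  .ofTensorHom
    (id_tensorHom_id := fun A B => by ext x; exact starMap_id x)
    (id_tensorHom := fun _ _ _ _ => rfl)
    (tensorHom_id := fun _ _ => rfl)
    (tensorHom_comp_tensorHom := fun f₁ f₂ g₁ g₂ => by ext x; exact starMap_comp _ _ _ _ x)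
    (associator_naturality := fun f g h => by ext x; exact assoc_natural f g h x)
    (leftUnitor_naturality := fun f => by ext x; rcases x with ⟨⟨⟩⟩ | ⟨_, ⟨⟩, _⟩ | a; rfl)
    (rightUnitor_naturality := fun f => by ext x; rcases x with a | ⟨_, _, ⟨⟩⟩ | ⟨⟨⟩⟩; rfl)
    (pentagon := fun A B C D => by ext x; exact assoc_pentagon x)
    (triangle := fun A B => by
      ext x
      rcases x with (a | ⟨_, _, ⟨⟩⟩ | ⟨⟨⟩⟩) | ⟨r, a | ⟨_, _, ⟨⟩⟩ | ⟨⟨⟩⟩, c⟩ | c <;> rfl)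

/-- The symmetry of the Giry monoidal structure. -/
noncomputable abbrev symmetric :
    letI := monoidal.{u}
    SymmetricCategory (Type u) :=
  letI := monoidal.{u}
  { braiding := fun A B => (swapEquiv A B).toIso
    braiding_naturality_right := fun A B C f => by
      ext x; rcases x with a | ⟨r, a, b⟩ | b <;> rfl
    braiding_naturality_left := fun f Z => by
      ext x; rcases x with a | ⟨r, a, b⟩ | b <;> rfl
    hexagon_forward := fun A B C => by ext x; exact hexagon x
    hexagon_reverse := fun A B C => by
      ext x
      exact hexagon_inv x
    symmetry := fun A B => by ext x; exact swapFun_swapFun x }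

theorem join_map_single {A : Type u} (x : Convexity.StdSimplex ℝ A) :
    (x.map Convexity.StdSimplex.single).join = x := by
  apply Convexity.StdSimplex.ext
  rw [Convexity.StdSimplex.weights_join, Convexity.StdSimplex.weights_map,
    Finsupp.sum_mapDomain_index (by simp) (by simp [add_smul])]
  simp

/-- The finite Giry monad: `D A` is the set of finitely supported probability distributions on `A`,
`D f` is pushforward, the unit sends `a` to the point mass at `a`, and the multiplication sends
`∑ λᵢ · ωᵢ` to `a ↦ ∑ λᵢ ωᵢ(a)`. -/
noncomputable def monad : Monad (Type u) where
  obj A := Convexity.StdSimplex ℝ A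
  map f := ↾(Convexity.StdSimplex.map f)
  map_id A := by ext x : 3; exact Convexity.StdSimplex.map_id x
  map_comp f g := by ext x : 3; exact Convexity.StdSimplex.map_comp x f g
  η := { app := fun A => ↾Convexity.StdSimplex.single
         naturality := fun A B f => by
          ext x : 3; exact (Convexity.StdSimplex.map_single x f).symm }
  μ := { app := fun A => ↾Convexity.StdSimplex.join
         naturality := fun A B f => by
          ext x : 3; exact (Convexity.StdSimplex.map_sConvexComb x f).symm }
  assoc A := by ext x : 3; exact (Convexity.sConvexComb_sConvexComb x).symm
  left_unit A := by
    ext x : 3; exact Convexity.sConvexComb_single (R := ℝ) (M := Convexity.StdSimplex ℝ A) x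
  right_unit A := by
    ext x : 3; exact join_map_single x

/-- The two-point distribution `r · x + r* · y`. -/
noncomputable def mix {A : Type u} (r : Weight) (x y : A) : Convexity.StdSimplex ℝ A :=
  .duple x y r.2.1.le (compl r).2.1.le (add_sub_cancel r.1 1)

end Giry

/-! An element of `A ⋆ B` is a distribution on `A + B` charging at most one point of each side: `(r,
a, b)` stands for `r · a + r* · b`. Likewise `D A ⋆ D B` is all of `D (A + B)`: a distribution on a
sum is a weight together with its two conditional distributions, and a side of mass zero accounts
for the outer summands (`distEmbed_injective`, `exists_distEmbed_eq`). Averaging sends `p` in `D (A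
⋆ B)` to a distribution on `A + B`, hence to an element `split p` of `D A ⋆ D B`; this is the
opmonoidal constraint.

The embedding `starEmbed` into `V × W` turns the associativity and the symmetry of `⋆` into those of
the product of vector spaces. Since it is injective on distributions, each opmonoidal axiom becomes
an identity of linear maps in the weights of `p`, which is checked on basis vectors.

In the algebra `X ⋆ Y` the element `(r, x, y)` is the combination of `x` and `y` with weights `r`,
`r*` (`act_starAlgebra_mix`), so an algebra map out of it is determined on the outer summands.
Conversely, the copairing forced by this is an algebra map (`copair_split`), because splitting a
distribution and remixing its two parts gives back its average (`bindStar_split`). -/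

namespace Giry

open Convexity

/-! ### Embedding `X ⋆ Y` into a product of vector spaces -/

section Cone

variable {X Y X' Y' : Type u} {V W V' W' : Type*} [AddCommGroup V] [Module ℝ V]
  [AddCommGroup W] [Module ℝ W] [AddCommGroup V'] [Module ℝ V'] [AddCommGroup W'] [Module ℝ W']

/-- The map `X ⋆ Y → V × W` induced by `f : X → V` and `g : Y → W`, which sends `(r, x, y)` to the
convex combination `r • (f x, 0) + r* • (0, g y)`. -/
def starEmbed (f : X → V) (g : Y → W) : Star X Y → V × W
  | .inl x => (f x, 0)
  | .inr (.inl (r, x, y)) => (r.1 • f x, (1 - r.1) • g y)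
  | .inr (.inr y) => (0, g y)

/-- The map `X ⋆ Y → V × W` induced by maps into affine hyperplanes is injective if both maps
are. -/
theorem starEmbed_injective {f : X → V} {g : Y → W} (hf : Function.Injective f)
    (hg : Function.Injective g) (s : V →ₗ[ℝ] ℝ) (t : W →ₗ[ℝ] ℝ) (hs : ∀ x, s (f x) = 1)
    (ht : ∀ y, t (g y) = 1) : Function.Injective (starEmbed f g) := by
  -- Values on the hyperplanes are nonzero, so the vanishing of a component tells the three summands
  -- apart.
  have hf0 : ∀ x, f x ≠ 0 := fun x h => by simpa [h] using hs x
  have hg0 : ∀ y, g y ≠ 0 := fun y h => by simpa [h] using ht y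
  have hr : ∀ r : Weight, r.1 ≠ 0 := fun r => r.2.1.ne'
  have hr' : ∀ r : Weight, 1 - r.1 ≠ 0 := fun r => (compl r).2.1.ne'
  rintro (x | ⟨r, x, y⟩ | y) (x' | ⟨r', x', y'⟩ | y') h <;>
    simp only [starEmbed, Prod.mk.injEq] at h
  · rw [hf h.1]
  · exact absurd h.2.symm (smul_ne_zero (hr' _) (hg0 _))
  · exact absurd h.1 (hf0 _)
  · exact absurd h.2 (smul_ne_zero (hr' _) (hg0 _))
  · obtain ⟨h₁, h₂⟩ := h
    -- The functional `s` reads off the weight, after which it can be cancelled.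
    have e : r = r' := Subtype.ext (by simpa [hs] using congrArg s h₁)
    subst e
    rw [hf (smul_right_injective V (hr r) h₁), hg (smul_right_injective W (hr' r) h₂)]
  · exact absurd h.1 (smul_ne_zero (hr _) (hf0 _))
  · exact absurd h.1.symm (hf0 _)
  · exact absurd h.1.symm (smul_ne_zero (hr _) (hf0 _))
  · rw [hg h.2]

/-- The image again lies in an affine hyperplane, so the embedding can be iterated for triple
products. -/
theorem coprod_starEmbed (f : X → V) (g : Y → W) (s : V →ₗ[ℝ] ℝ) (t : W →ₗ[ℝ] ℝ)
    (hs : ∀ x, s (f x) = 1) (ht : ∀ y, t (g y) = 1) (z : Star X Y) :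
    s.coprod t (starEmbed f g z) = 1 := by
  rcases z with x | ⟨r, x, y⟩ | y <;> simp [starEmbed, hs, ht]

theorem starEmbed_starMap (f : X' → V) (g : Y' → W) (u : X → X') (v : Y → Y') (z : Star X Y) :
    starEmbed f g (starMap u v z) = starEmbed (fun x => f (u x)) (fun y => g (v y)) z := by
  rcases z with x | ⟨r, x, y⟩ | y <;> rfl

theorem starEmbed_linear (f : X → V) (g : Y → W) (s : V →ₗ[ℝ] V') (t : W →ₗ[ℝ] W')
    (z : Star X Y) :
    starEmbed (fun x => s (f x)) (fun y => t (g y)) z = s.prodMap t (starEmbed f g z) := by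
  rcases z with x | ⟨r, x, y⟩ | y <;> simp [starEmbed]

/-- The formula for `v` is rebracketing: `(r, (s, a, b), c)` and its image both have coefficients `r
s`, `r s*`, `r*` at `a`, `b`, `c`. The last two are `e₁` and `e₂`. -/
theorem starEmbed_assocFun {Z : Type u} {U : Type*} [AddCommGroup U] [Module ℝ U] (f : X → V)
    (g : Y → W) (h : Z → U) (z : Star (Star X Y) Z) :
    starEmbed f (starEmbed g h) (assocFun z) =
      LinearEquiv.prodAssoc ℝ V W U (starEmbed (starEmbed f g) h z) := by
  have e₁ (r s : Weight) : (1 - r.1 * s.1) * (vSnd r s).1 = r.1 * (1 - s.1) := by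
    have h := mul_ne_one' r s
    simp only [vSnd]
    field_simp
  have e₂ (r s : Weight) : (1 - r.1 * s.1) * (1 - (vSnd r s).1) = 1 - r.1 := by
    rw [mul_sub, e₁]
    ring
  rcases z with (a | ⟨r, a, b⟩ | b) | ⟨r, a | ⟨s, a, b⟩ | b, c⟩ | c <;>
    simp [starEmbed, assocFun, LinearEquiv.prodAssoc, vFst, smul_smul, e₁, e₂]
  rfl

theorem starEmbed_swapFun (f : X → V) (g : Y → W) (z : Star X Y) :
    starEmbed g f (swapFun z) = (starEmbed f g z).swap := by
  rcases z with x | ⟨r, x, y⟩ | y <;> simp [starEmbed, swapFun, compl]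

end Cone

/-! ### The constraint `split` and its compatibilities -/

section Split

variable {A B A' B' : Type u}

/-- The total mass of a finitely supported function. -/
noncomputable def mass (A : Type u) : (A →₀ ℝ) →ₗ[ℝ] ℝ :=
  Finsupp.linearCombination ℝ fun _ => 1

theorem mass_apply (p : A →₀ ℝ) : mass A p = p.sum fun _ r => r := by
  simp [mass, Finsupp.linearCombination_apply]

@[simp]
theorem mass_weights (p : StdSimplex ℝ A) : mass A p.weights = 1 := by
  rw [mass_apply, p.total]

theorem mass_nonneg {p : A →₀ ℝ} (hp : 0 ≤ p) : 0 ≤ mass A p := by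
  rw [mass_apply]; exact Finset.sum_nonneg fun a _ => hp a

theorem eq_zero_of_mass_eq_zero {p : A →₀ ℝ} (hp : 0 ≤ p) (h : mass A p = 0) : p = 0 := by
  rw [mass_apply, Finsupp.sum, Finset.sum_eq_zero_iff_of_nonneg fun a _ => hp a] at h
  ext a
  by_contra ha
  exact ha (h a (Finsupp.mem_support_iff.2 ha))

theorem exists_weights_eq {p : A →₀ ℝ} (hp : 0 ≤ p) (h : mass A p = 1) :
    ∃ w : StdSimplex ℝ A, w.weights = p :=
  ⟨⟨p, hp, by rw [← mass_apply, h]⟩, rfl⟩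

theorem exists_smul_weights_eq {p : A →₀ ℝ} (hp : 0 ≤ p) (h : mass A p ≠ 0) :
    ∃ w : StdSimplex ℝ A, mass A p • w.weights = p := by
  obtain ⟨w, hw⟩ := exists_weights_eq (p := (mass A p)⁻¹ • p)
    (smul_nonneg (inv_nonneg.2 (mass_nonneg hp)) hp) (by simp [h])
  exact ⟨w, by rw [hw, smul_inv_smul₀ h]⟩

theorem weights_injective : Function.Injective (StdSimplex.weights : StdSimplex ℝ A → A →₀ ℝ) :=
  fun _ _ => StdSimplex.ext

/-- An element of `A ⋆ B` is viewed as a distribution on `A + B`. -/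
noncomputable def pointEmbed : Star A B → (A →₀ ℝ) × (B →₀ ℝ) :=
  starEmbed (fun a => Finsupp.single a 1) (fun b => Finsupp.single b 1)

/-- An element of `D A ⋆ D B` is viewed as a distribution on `A + B`. -/
noncomputable def distEmbed :
    Star (StdSimplex ℝ A) (StdSimplex ℝ B) → (A →₀ ℝ) × (B →₀ ℝ) :=
  starEmbed StdSimplex.weights StdSimplex.weights

theorem distEmbed_injective :
    Function.Injective
      (distEmbed : Star (StdSimplex ℝ A) (StdSimplex ℝ B) → (A →₀ ℝ) × (B →₀ ℝ)) :=
  starEmbed_injective weights_injective weights_injective (mass A) (mass B) mass_weights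
    mass_weights

theorem mass_distEmbed (z : Star (StdSimplex ℝ A) (StdSimplex ℝ B)) :
    (mass A).coprod (mass B) (distEmbed z) = 1 :=
  coprod_starEmbed _ _ _ _ mass_weights mass_weights z

/-- The cases are mass only on `B`, mass only on `A`, and mass on both sides; in the last one both
parts are normalised and the weight is the mass of `p`. -/
theorem exists_distEmbed_eq {p : A →₀ ℝ} {q : B →₀ ℝ} (hp : 0 ≤ p) (hq : 0 ≤ q)
    (h : mass A p + mass B q = 1) :
    ∃ z : Star (StdSimplex ℝ A) (StdSimplex ℝ B), distEmbed z = (p, q) := by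
  by_cases hp0 : mass A p = 0
  · obtain ⟨w, rfl⟩ := exists_weights_eq hq (by simpa [hp0] using h)
    exact ⟨.inr (.inr w), by rw [eq_zero_of_mass_eq_zero hp hp0]; rfl⟩
  by_cases hq0 : mass B q = 0
  · obtain ⟨w, rfl⟩ := exists_weights_eq hp (by simpa [hq0] using h)
    exact ⟨.inl w, by rw [eq_zero_of_mass_eq_zero hq hq0]; rfl⟩
  obtain ⟨v, hv⟩ := exists_smul_weights_eq hp hp0
  obtain ⟨w, hw⟩ := exists_smul_weights_eq hq hq0
  have hp1 : 0 < mass A p := (mass_nonneg hp).lt_of_ne' hp0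
  have hq1 : 0 < mass B q := (mass_nonneg hq).lt_of_ne' hq0
  refine ⟨.inr (.inl (⟨mass A p, hp1, by linarith⟩, v, w)), ?_⟩
  change (mass A p • v.weights, (1 - mass A p) • w.weights) = (p, q)
  rw [hv, sub_eq_of_eq_add' h.symm, hw]

/-- The linear extension of `pointEmbed`. -/
noncomputable def pointExtend (A B : Type u) : (Star A B →₀ ℝ) →ₗ[ℝ] (A →₀ ℝ) × (B →₀ ℝ) :=
  Finsupp.linearCombination ℝ pointEmbed

@[simp]
theorem pointExtend_single (z : Star A B) (r : ℝ) :
    pointExtend A B (.single z r) = r • pointEmbed z := by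
  simp [pointExtend]

theorem pointEmbed_nonneg (z : Star A B) : 0 ≤ pointEmbed z := by
  rcases z with a | ⟨r, a, b⟩ | b
  · simp [pointEmbed, starEmbed, Prod.le_def]
  · simp [pointEmbed, starEmbed, Prod.le_def, r.2.1.le, r.2.2.le]
  · simp [pointEmbed, starEmbed, Prod.le_def]

theorem pointExtend_nonneg {p : Star A B →₀ ℝ} (hp : 0 ≤ p) : 0 ≤ pointExtend A B p := by
  rw [pointExtend, Finsupp.linearCombination_apply]
  exact Finset.sum_nonneg fun z _ => smul_nonneg (hp z) (pointEmbed_nonneg z)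

theorem mass_pointExtend (p : Star A B →₀ ℝ) :
    (mass A).coprod (mass B) (pointExtend A B p) = mass _ p := by
  suffices h : (mass A).coprod (mass B) ∘ₗ pointExtend A B = mass _ from LinearMap.congr_fun h p
  ext z
  have := coprod_starEmbed (fun a => Finsupp.single a 1) (fun b => Finsupp.single b 1) (mass A)
    (mass B) (by simp [mass]) (by simp [mass]) z
  simpa [mass, pointEmbed] using this

theorem exists_split (p : StdSimplex ℝ (Star A B)) :
    ∃ z : Star (StdSimplex ℝ A) (StdSimplex ℝ B), distEmbed z = pointExtend A B p.weights := by
  have h := pointExtend_nonneg p.nonneg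
  exact exists_distEmbed_eq h.1 h.2 ((mass_pointExtend _).trans (mass_weights p))

/-- The opmonoidal constraint `D (A ⋆ B) → D A ⋆ D B`: the two conditional distributions, weighted
by the total masses. -/
noncomputable def split (p : StdSimplex ℝ (Star A B)) : Star (StdSimplex ℝ A) (StdSimplex ℝ B) :=
  (exists_split p).choose

theorem distEmbed_split (p : StdSimplex ℝ (Star A B)) :
    distEmbed (split p) = pointExtend A B p.weights :=
  (exists_split p).choose_spec

/-- Characterises the chosen `split p`, so that later identities are verified in the vector space.
-/
theorem split_eq {p : StdSimplex ℝ (Star A B)} {z : Star (StdSimplex ℝ A) (StdSimplex ℝ B)}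
    (h : pointExtend A B p.weights = distEmbed z) : split p = z :=
  distEmbed_injective ((distEmbed_split p).trans h)

theorem split_single (z : Star A B) :
    split (.single z) = starMap StdSimplex.single StdSimplex.single z :=
  split_eq (by simp [distEmbed, starEmbed_starMap, pointEmbed])

theorem split_map (f : A → A') (g : B → B') (p : StdSimplex ℝ (Star A B)) :
    split (p.map (starMap f g)) = starMap (StdSimplex.map f) (StdSimplex.map g) (split p) := by
  apply split_eq
  -- Both sides are linear in the weights, so it suffices to compare them on point masses; the
  -- lemmas below follow the same pattern.
  have h : pointExtend A' B' ∘ₗ Finsupp.lmapDomain ℝ ℝ (starMap f g) =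
      (Finsupp.lmapDomain ℝ ℝ f).prodMap (Finsupp.lmapDomain ℝ ℝ g) ∘ₗ pointExtend A B := by
    refine Finsupp.lhom_ext' fun z => LinearMap.ext_ring ?_
    simp only [LinearMap.comp_apply, Finsupp.lsingle_apply, pointExtend_single, one_smul,
      Finsupp.lmapDomain_apply, Finsupp.mapDomain_single]
    rw [pointEmbed, pointEmbed, ← starEmbed_linear, starEmbed_starMap]
    simp
  refine (LinearMap.congr_fun h p.weights).trans ?_
  rw [LinearMap.comp_apply, ← distEmbed_split, distEmbed, distEmbed, ← starEmbed_linear,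
    starEmbed_starMap]
  rfl

/-- Pushforward along `split` is linear in the weights whatever `split` is, so on a basis vector the
claim is just `distEmbed_split`. -/
theorem split_join (p : StdSimplex ℝ (StdSimplex ℝ (Star A B))) :
    split p.join = starMap StdSimplex.join StdSimplex.join (split (p.map split)) := by
  apply split_eq
  -- The linear extension of `join`.
  let J (A : Type u) : (StdSimplex ℝ A →₀ ℝ) →ₗ[ℝ] (A →₀ ℝ) :=
    Finsupp.linearCombination ℝ StdSimplex.weights
  have hJ (A : Type u) (q : StdSimplex ℝ (StdSimplex ℝ A)) : q.join.weights = J A q.weights := by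
    simp [J, Finsupp.linearCombination_apply]
  have h : pointExtend A B ∘ₗ J _ =
      (J A).prodMap (J B) ∘ₗ pointExtend _ _ ∘ₗ Finsupp.lmapDomain ℝ ℝ split := by
    refine Finsupp.lhom_ext' fun z => LinearMap.ext_ring ?_
    simp only [LinearMap.comp_apply, Finsupp.lsingle_apply, pointExtend_single, one_smul,
      Finsupp.lmapDomain_apply, Finsupp.mapDomain_single]
    rw [pointEmbed, ← starEmbed_linear]
    simp [J, ← distEmbed_split, distEmbed]
  rw [hJ, distEmbed, starEmbed_starMap]
  simp only [hJ]
  rw [starEmbed_linear, ← distEmbed, distEmbed_split]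
  exact LinearMap.congr_fun h p.weights

theorem split_swap (p : StdSimplex ℝ (Star A B)) :
    split (p.map swapFun) = swapFun (split p) := by
  apply split_eq
  have h : pointExtend B A ∘ₗ Finsupp.lmapDomain ℝ ℝ swapFun =
      (LinearEquiv.prodComm ℝ _ _).toLinearMap ∘ₗ pointExtend A B := by
    refine Finsupp.lhom_ext' fun z => LinearMap.ext_ring ?_
    simp [pointEmbed, starEmbed_swapFun]
  refine (LinearMap.congr_fun h p.weights).trans ?_
  rw [LinearMap.comp_apply, ← distEmbed_split, distEmbed, distEmbed, starEmbed_swapFun]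
  rfl

theorem split_assoc {C : Type u} (p : StdSimplex ℝ (Star (Star A B) C)) :
    assocFun (starMap split id (split p)) = starMap id split (split (p.map assocFun)) := by
  -- Both sides are compared in the space of triples, using the iterated embedding; on its second
  -- factor the hyperplane is total mass one on `B + C`.
  apply starEmbed_injective weights_injective distEmbed_injective (mass A)
    ((mass B).coprod (mass C)) mass_weights mass_distEmbed
  have h : (LinearEquiv.prodAssoc ℝ _ _ _).toLinearMap ∘ₗ
        (pointExtend A B).prodMap LinearMap.id ∘ₗ pointExtend (Star A B) C =
      LinearMap.id.prodMap (pointExtend B C) ∘ₗ pointExtend A (Star B C) ∘ₗ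
        Finsupp.lmapDomain ℝ ℝ assocFun := by
    refine Finsupp.lhom_ext' fun z => LinearMap.ext_ring ?_
    have := starEmbed_assocFun (fun a : A => Finsupp.single a (1 : ℝ))
      (fun b : B => Finsupp.single b (1 : ℝ)) (fun c : C => Finsupp.single c (1 : ℝ)) z
    simp only [LinearMap.comp_apply, Finsupp.lsingle_apply, pointExtend_single, one_smul,
      Finsupp.lmapDomain_apply, Finsupp.mapDomain_single]
    rw [pointEmbed, pointEmbed, ← starEmbed_linear, ← starEmbed_linear]
    simpa [pointEmbed] using this.symm
  have e₁ := starEmbed_linear (StdSimplex.weights (R := ℝ) (M := Star A B))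
    (StdSimplex.weights (R := ℝ) (M := C)) (pointExtend A B) LinearMap.id (split p)
  have e₂ := starEmbed_linear (StdSimplex.weights (R := ℝ) (M := A))
    (StdSimplex.weights (R := ℝ) (M := Star B C)) LinearMap.id (pointExtend B C)
    (split (p.map assocFun))
  rw [distEmbed, starEmbed_assocFun, ← distEmbed, ← distEmbed, starEmbed_starMap,
    starEmbed_starMap]
  simp only [distEmbed_split, id]
  refine (congrArg _ e₁).trans (Eq.trans ?_ e₂.symm)
  rw [← distEmbed, ← distEmbed, distEmbed_split, distEmbed_split]
  exact LinearMap.congr_fun h p.weights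

theorem split_map_inl (p : StdSimplex ℝ A) :
    split (p.map (Sum.inl : A → Star A B)) = .inl p := by
  apply split_eq
  have h : pointExtend A B ∘ₗ Finsupp.lmapDomain ℝ ℝ Sum.inl = LinearMap.inl ℝ _ _ := by
    refine Finsupp.lhom_ext' fun z => LinearMap.ext_ring ?_
    simp [pointEmbed, starEmbed]
  exact LinearMap.congr_fun h p.weights

theorem split_map_inr (p : StdSimplex ℝ B) :
    split (p.map (fun b => (.inr (.inr b) : Star A B))) = .inr (.inr p) := by
  apply split_eq
  have h : pointExtend A B ∘ₗ Finsupp.lmapDomain ℝ ℝ (fun b => .inr (.inr b)) =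
      LinearMap.inr ℝ _ _ := by
    refine Finsupp.lhom_ext' fun z => LinearMap.ext_ring ?_
    simp [pointEmbed, starEmbed]
  exact LinearMap.congr_fun h p.weights

theorem split_mix (r : Weight) (a : A) (b : B) :
    split (mix r (.inl a : Star A B) (.inr (.inr b))) =
      .inr (.inl (r, .single a, .single b)) := by
  apply split_eq
  simp [mix, pointEmbed, distEmbed, starEmbed, compl]

end Split

/-! ### Remixing the two parts of a split distribution -/

section Copair

variable {A B Z : Type u}

/-- The distribution on `Z` determined by an element of `A ⋆ B` and maps `A → D Z`, `B → D Z`. -/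
noncomputable def bindStar (f : A → StdSimplex ℝ Z) (g : B → StdSimplex ℝ Z) :
    Star A B → StdSimplex ℝ Z
  | .inl a => f a
  | .inr (.inl (r, a, b)) => (mix r (f a) (g b)).join
  | .inr (.inr b) => g b

/-- Mixing is the embedding followed by addition, which brings `bindStar` within reach of the linear
argument. -/
theorem weights_bindStar (f : A → StdSimplex ℝ Z) (g : B → StdSimplex ℝ Z) (z : Star A B) :
    (bindStar f g z).weights =
      (LinearMap.id (R := ℝ)).coprod LinearMap.id
        (starEmbed (fun a => (f a).weights) (fun b => (g b).weights) z) := by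
  rcases z with a | ⟨r, a, b⟩ | b
  · simp [bindStar, starEmbed]
  · exact (StdSimplex.weights_convexCombPair (f a) (g b) r.1 (1 - r.1) r.2.1.le
      (compl r).2.1.le (add_sub_cancel r.1 1)).trans (by simp [starEmbed])
  · simp [bindStar, starEmbed]

/-- The heart of the coproduct property, in the case of free algebras: both sides are the
pushforward to `Z` of the average of `p` on `A + B`. -/
theorem bindStar_split (f : A → Z) (g : B → Z) (p : StdSimplex ℝ (Star A B)) :
    bindStar (StdSimplex.map f) (StdSimplex.map g) (split p) =
      (p.map (bindStar (fun a => .single (f a)) (fun b => .single (g b)))).join := by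
  apply StdSimplex.ext
  let F : (A →₀ ℝ) →ₗ[ℝ] (Z →₀ ℝ) := Finsupp.lmapDomain ℝ ℝ f
  let G : (B →₀ ℝ) →ₗ[ℝ] (Z →₀ ℝ) := Finsupp.lmapDomain ℝ ℝ g
  have h : LinearMap.id.coprod LinearMap.id ∘ₗ F.prodMap G ∘ₗ pointExtend A B =
      Finsupp.linearCombination ℝ StdSimplex.weights ∘ₗ
        Finsupp.lmapDomain ℝ ℝ (bindStar (fun a => .single (f a)) (fun b => .single (g b))) := by
    refine Finsupp.lhom_ext' fun z => LinearMap.ext_ring ?_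
    simp only [LinearMap.comp_apply, Finsupp.lsingle_apply, pointExtend_single, one_smul,
      Finsupp.lmapDomain_apply, Finsupp.mapDomain_single, Finsupp.linearCombination_single,
      weights_bindStar]
    rw [pointEmbed, ← starEmbed_linear]
    simp [F, G]
  rw [weights_bindStar, StdSimplex.weights_join, StdSimplex.weights_map,
    ← Finsupp.linearCombination_apply]
  refine Eq.trans ?_ (LinearMap.congr_fun h p.weights)
  rw [LinearMap.comp_apply, LinearMap.comp_apply, ← distEmbed_split, distEmbed, ← starEmbed_linear]
  rfl

end Copair

/-! ### The opmonoidal monad structure -/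

section Opmonoidal

attribute [local instance] monoidal symmetric

theorem map_id_eq (A : Type u) : (StdSimplex.map id : StdSimplex ℝ A → StdSimplex ℝ A) = id :=
  funext StdSimplex.map_id

/-- The opmonoidal structure of the finite Giry monad. -/
noncomputable abbrev oplaxMonoidal : monad.{u}.toFunctor.OplaxMonoidal where
  -- A distribution needs a point to live on, so `D ∅` is empty and this is the empty map.
  η := ↾fun p : StdSimplex ℝ PEmpty.{u + 1} => (StdSimplex.nonempty p).some
  δ A B := ↾fun p : StdSimplex ℝ (Star A B) => split p
  δ_natural_left f B := by
    ext p
    have h := split_map f id p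
    rw [map_id_eq] at h
    exact h.symm
  δ_natural_right A f := by
    ext p
    have h := split_map id f p
    rw [map_id_eq] at h
    exact h.symm
  oplax_associativity A B C := by ext p; exact split_assoc p
  oplax_left_unitality A := by
    ext p
    exact (congrArg (starMap _ id) (split_map_inr p)).symm
  oplax_right_unitality A := by
    ext p
    exact (congrArg (starMap id _) (split_map_inl p)).symm

/-- The finite Giry monad is symmetric opmonoidal. -/
noncomputable abbrev opmonoidalMonad : SymmetricOpmonoidalMonad monad.{u} where
  oplax := oplaxMonoidal
  braided A B := by ext p; exact (split_swap p).symm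
  unit_counit := by ext p; exact p.elim
  unit_tensor A B := by ext z; exact split_single z
  mul_counit := by ext p; exact (StdSimplex.nonempty (StdSimplex.nonempty p).some).some.elim
  mul_tensor A B := by ext p; exact split_join p

end Opmonoidal

/-! ### Algebras and the copairing -/

section Algebra

variable (X Y Z : monad.{u}.Algebra)

/-- The action of a `D`-algebra, as a function. -/
def act (p : StdSimplex ℝ X.A) : X.A := X.a p

theorem act_single (x : X.A) : act X (.single x) = x := ConcreteCategory.congr_hom X.unit x

theorem act_join (p : StdSimplex ℝ (StdSimplex ℝ X.A)) :
    act X p.join = act X (p.map (act X)) := ConcreteCategory.congr_hom X.assoc p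

variable {X Y Z}

theorem hom_act (f : X ⟶ Y) (p : StdSimplex ℝ X.A) : f.f (act X p) = act Y (p.map f.f) :=
  (ConcreteCategory.congr_hom f.h p).symm

/-- A function that commutes with the actions is a map of `D`-algebras. -/
def homMk (f : X.A → Y.A) (h : ∀ p : StdSimplex ℝ X.A, f (act X p) = act Y (p.map f)) :
    X ⟶ Y where
  f := ↾f
  h := by ext p; exact (h p).symm

theorem hom_ext {f g : X ⟶ Y} (h : ∀ x : X.A, f.f x = g.f x) : f = g :=
  Monad.Algebra.Hom.ext (by ext x; exact h x)

theorem map_mix {A B : Type u} (f : A → B) (r : Weight) (x y : A) :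
    (mix r x y).map f = mix r (f x) (f y) :=
  StdSimplex.map_duple _ _ _ x y f

/-- The copairing `X ⋆ Y → Z` of two functions into a `D`-algebra. -/
noncomputable def copair (f : X.A → Z.A) (g : Y.A → Z.A) : Star X.A Y.A → Z.A
  | .inl x => f x
  | .inr (.inl (r, x, y)) => act Z (mix r (f x) (g y))
  | .inr (.inr y) => g y

theorem copair_starMap (f : X ⟶ Z) (g : Y ⟶ Z)
    (z : Star (StdSimplex ℝ X.A) (StdSimplex ℝ Y.A)) :
    copair f.f g.f (starMap (act X) (act Y) z) =
      act Z (bindStar (StdSimplex.map f.f) (StdSimplex.map g.f) z) := by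
  rcases z with p | ⟨r, p, q⟩ | q
  · exact hom_act f p
  · simp only [starMap, Sum.map_inr, Sum.map_inl, Prod.map, copair, bindStar, hom_act, act_join,
      map_mix, id]
  · exact hom_act g q

theorem copair_eq_act (f : X.A → Z.A) (g : Y.A → Z.A) (z : Star X.A Y.A) :
    copair f g z = act Z (bindStar (fun x => .single (f x)) (fun y => .single (g y)) z) := by
  rcases z with x | ⟨r, x, y⟩ | y
  · exact (act_single Z _).symm
  · simp only [copair, bindStar, act_join, map_mix, act_single]
  · exact (act_single Z _).symm

/-- This says that the copairing is an algebra map. Both sides are the action of `Z` on a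
distribution, and `bindStar_split` with associativity of the action identifies the results. -/
theorem copair_split (f : X ⟶ Z) (g : Y ⟶ Z) (p : StdSimplex ℝ (Star X.A Y.A)) :
    copair f.f g.f (starMap (act X) (act Y) (split p)) = act Z (p.map (copair f.f g.f)) := by
  rw [copair_starMap, bindStar_split, act_join, StdSimplex.map_map]
  simp only [← copair_eq_act]

end Algebra

/-! ### The tensor product of algebras as coproduct -/

section Coproducts

attribute [local instance] monoidal symmetric

variable (X Y : monad.{u}.Algebra)

/-- The tensor product of `D`-algebras. -/
noncomputable abbrev starAlgebra : monad.{u}.Algebra := opmonoidalMonad.tensorAlgebra X Y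

theorem act_starAlgebra (p : StdSimplex ℝ (Star X.A Y.A)) :
    act (starAlgebra X Y) p = starMap (act X) (act Y) (split p) := rfl

/-- The first injection into the tensor product of `D`-algebras. -/
noncomputable def starInl : X ⟶ starAlgebra X Y :=
  homMk (Sum.inl : X.A → Star X.A Y.A) fun p => by
    rw [act_starAlgebra, split_map_inl]; rfl

/-- The second injection into the tensor product of `D`-algebras. -/
noncomputable def starInr : Y ⟶ starAlgebra X Y :=
  homMk (fun y => (.inr (.inr y) : Star X.A Y.A)) fun p => by
    rw [act_starAlgebra, split_map_inr]; rfl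

theorem act_starAlgebra_mix (r : Weight) (x : X.A) (y : Y.A) :
    act (starAlgebra X Y) (mix r (.inl x : Star X.A Y.A) (.inr (.inr y))) =
      .inr (.inl (r, x, y)) := by
  rw [act_starAlgebra, split_mix]
  simp only [starMap, Sum.map_inr, Sum.map_inl, Prod.map, act_single, id]

variable {X Y} in
/-- The map out of the tensor product of `D`-algebras given by two maps of `D`-algebras. -/
noncomputable def starDesc {Z : monad.{u}.Algebra} (f : X ⟶ Z) (g : Y ⟶ Z) :
    starAlgebra X Y ⟶ Z :=
  homMk (X := starAlgebra X Y) (copair f.f g.f) (copair_split f g)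

variable {X Y} in
theorem starHom_eq {Z : monad.{u}.Algebra} {h k : starAlgebra X Y ⟶ Z}
    (hl : starInl X Y ≫ h = starInl X Y ≫ k) (hr : starInr X Y ≫ h = starInr X Y ≫ k) :
    h = k := by
  have el (x : X.A) : h.f (.inl x : Star X.A Y.A) = k.f (.inl x : Star X.A Y.A) :=
    ConcreteCategory.congr_hom (congrArg Monad.Algebra.Hom.f hl) x
  have er (y : Y.A) : h.f (.inr (.inr y) : Star X.A Y.A) = k.f (.inr (.inr y) : Star X.A Y.A) :=
    ConcreteCategory.congr_hom (congrArg Monad.Algebra.Hom.f hr) y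
  apply hom_ext
  rintro (x | ⟨r, x, y⟩ | y)
  · exact el x
  -- A middle element is a convex combination of outer ones, and algebra maps preserve it.
  · rw [← act_starAlgebra_mix, hom_act, hom_act, map_mix, map_mix, el, er]
  · exact er y

/-- The tensor product of `D`-algebras is their coproduct. -/
noncomputable def isColimitStar : IsColimit (BinaryCofan.mk (starInl X Y) (starInr X Y)) :=
  BinaryCofan.isColimitMk (fun s => starDesc s.inl s.inr) (fun _ => rfl) (fun _ => rfl)
    (fun _ _ hl hr => starHom_eq hl hr)

/-- The unit `D`-algebra is initial. -/
noncomputable def isInitialUnitAlgebra : IsInitial opmonoidalMonad.{u}.unitAlgebra :=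
  IsInitial.ofUniqueHom
    (fun _ => homMk (X := opmonoidalMonad.{u}.unitAlgebra) (fun e : PEmpty.{u + 1} => e.elim)
      fun p => (StdSimplex.nonempty p).some.elim)
    (fun _ _ => hom_ext fun e : PEmpty.{u + 1} => e.elim)

/-- The finite Giry monad is a linear exponential monad. -/
noncomputable def linearExponentialMonad : LinearExponentialMonad monad.{u} where
  toSymmetricOpmonoidalMonad := opmonoidalMonad
  coproducts :=
    letI := opmonoidalMonad.{u}.liftedMonoidal
    letI := opmonoidalMonad.{u}.liftedSymmetric
    { isInitialUnit := isInitialUnitAlgebra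
      inl := starInl
      inr := starInr
      isColimit := isColimitStar
      -- The tensor of maps and the constraints are those of sets, and on the summands hit by the
      -- injections they compute definitionally.
      inl_tensorHom := fun _ _ => rfl
      inr_tensorHom := fun _ _ => rfl
      inr_leftUnitor := fun _ => rfl
      inl_rightUnitor := fun _ => rfl
      inl_inl_associator := fun _ _ _ => rfl
      inr_inl_associator := fun _ _ _ => rfl
      inr_associator := fun _ _ _ => rfl
      inl_braiding := fun _ _ => rfl
      inr_braiding := fun _ _ => rfl }

end Coproducts

end Giry

/-! ### Strictness of the forgetful functor -/

section Strict

variable {C : Type u} [Category.{v} C] [MonoidalCategory C] [SymmetricCategory C]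

/-- The forgetful functor from algebras is strict symmetric monoidal for the lifted structure. -/
theorem SymmetricOpmonoidalMonad.isStrictSymmetricMonoidal_forget {T : Monad C}
    (S : SymmetricOpmonoidalMonad T) :
    letI := S.liftedMonoidal
    letI := S.liftedSymmetric
    IsStrictSymmetricMonoidal (Monad.forget T) :=
  letI := S.liftedMonoidal
  letI := S.liftedSymmetric
  { unit := rfl
    tensor := fun _ _ => rfl
    -- The object equalities hold by `rfl`, so each `eqToHom` is definitionally an identity.
    tensorHom := fun _ _ => ((Category.id_comp _).trans (Category.comp_id _)).symm
    associator := fun _ _ _ => ((Category.id_comp _).trans (Category.comp_id _)).symm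
    leftUnitor := fun _ => (Category.id_comp _).symm
    rightUnitor := fun _ => (Category.id_comp _).symm
    braiding := fun _ _ => ((Category.id_comp _).trans (Category.comp_id _)).symm }

end Strict

theorem mainTheorem1 :
    letI := Giry.monoidal.{u}
    letI := Giry.symmetric.{u}
    ∃ L : LinearExponentialMonad Giry.monad.{u},
      letI := L.liftedMonoidal
      letI := L.liftedSymmetric
      IsStrictSymmetricMonoidal (Monad.forget Giry.monad.{u}) ∧
      ∀ X Y : Giry.monad.{u}.Algebra,
        (∀ x : X.A, (L.coproducts.inl X Y).f x = (Sum.inl x : Giry.Star X.A Y.A)) ∧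
        (∀ y : Y.A, (L.coproducts.inr X Y).f y = (Sum.inr (Sum.inr y) : Giry.Star X.A Y.A)) ∧
        ∀ (r : Giry.Weight) (x : X.A) (y : Y.A),
          (X ⊗ Y).a (Giry.mix r (Sum.inl x : Giry.Star X.A Y.A) (Sum.inr (Sum.inr y))) =
            (Sum.inr (Sum.inl (r, x, y)) : Giry.Star X.A Y.A) := by
  let := Giry.monoidal.{u}
  let := Giry.symmetric.{u}
  exact ⟨Giry.linearExponentialMonad,
    SymmetricOpmonoidalMonad.isStrictSymmetricMonoidal_forget _,
    fun X Y => ⟨fun _ => rfl, fun _ => rfl, Giry.act_starAlgebra_mix X Y⟩⟩
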